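/- Let $X, Y$ be Souslin spaces, i.e. topological spaces that are images of Polish spaces under continuous mappings, and let $\mathcal P(\cdot)$ denote the set of Borel probability measures on a space. Let $\mu \in \mathcal P(X)$, $\nu \in \mathcal P(Y)$, and let $\eta = \eta_1 \otimes \eta_2$, where $\eta_1 \in \mathcal P(X)$ and $\eta_2 \in \mathcal P(Y)$ are non-atomic (every Borel set of positive measure has a Borel subset of strictly smaller positive measure). Let $\Phi \in L^1(\eta)$ and let $\Pi_\Phi(\mu,\nu;\eta)$ be the set of all $\sigma \in \mathcal P(X\times Y)$ with projections $\mu$ on $X$ and $\nu$ on $Y$ that are absolutely continuous with respect to $\eta$ and satisfy $\frac{d\sigma}{d\eta} \le \Phi$ $\eta$-a.e. Let $h \colon X\times Y \to \mathbb R$ be a Borel function that is bounded from below, put $I_h(\sigma) = \int_{X\times Y} h\, d\sigma \in (-\infty, +\infty]$, and suppose that $I_h(\sigma) < +\infty$ for at least one $\sigma \in \Pi_\Phi(\mu,\nu;\eta)$ (in particular, this set is nonempty). Suppose that $h$ is non-degenerate: there do not exist universally measurable functions $u \colon X \to \mathbb R$ and $v \colon Y \to \mathbb R$ such that $$\eta(\{(x,y)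 \in X\times Y : h(x,y) = u(x) + v(y)\}) > 0.$$ Then the Kantorovich problem with density constraints $$I_h(\sigma) \to \inf, \qquad \sigma \in \Pi_\Phi(\mu,\nu;\eta),$$ has an optimal solution $\sigma$, this optimal solution is unique, and it has the form $\sigma = I_W \Phi \cdot \eta$ for some Borel set $W \subset X\times Y$, where $I_W$ is the indicator function of $W$. -/

import Mathlib

open MeasureTheory

/-- A Souslin space: a topological space that is the image of a Polish space under a continuous
mapping, that is, whose underlying set is an analytic set (the Hausdorff property is not needed
and not required; the `σ`-algebra is the Borel one, by `BorelSpace` in the theorem). -/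
def IsSouslinSpace (X : Type*) [TopologicalSpace X] : Prop :=
  AnalyticSet (Set.univ : Set X)

/-- The definition of a Souslin space in terms of arbitrary Polish spaces. -/
theorem isSouslinSpace_iff {X : Type*} [TopologicalSpace X] :
    IsSouslinSpace X ↔ ∃ (P : Type) (_ : TopologicalSpace P) (_ : PolishSpace P) (f : P → X),
      Continuous f ∧ Function.Surjective f := by
  unfold IsSouslinSpace
  rw [analyticSet_iff_exists_polishSpace_range]
  simp only [Set.range_eq_univ]

/-- On a product of two Souslin spaces the product `σ`-algebra is the Borel `σ`-algebra of the
product topology. So "measurable" on `X × Y` below is the same as "Borel". -/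
theorem IsSouslinSpace.borelSpace_prod {X Y : Type*}
    [TopologicalSpace X] [MeasurableSpace X] [BorelSpace X]
    [TopologicalSpace Y] [MeasurableSpace Y] [BorelSpace Y]
    (hX : IsSouslinSpace X) (hY : IsSouslinSpace Y) : BorelSpace (X × Y) := by
  obtain ⟨P, _, _, f, hf, hf'⟩ := isSouslinSpace_iff.1 hX
  obtain ⟨Q, _, _, g, hg, hg'⟩ := isSouslinSpace_iff.1 hY
  have hc : Continuous (Prod.map f g) := hf.prodMap hg
  have hs : Function.Surjective (Prod.map f g) := hf'.prodMap hg'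
  refine ⟨le_antisymm prod_le_borel_prod ?_⟩
  refine MeasurableSpace.generateFrom_le fun O hO => ?_
  have hO' : IsOpen O := hO
  have key : ∀ z : O, ∃ u : Set X, ∃ v : Set Y, IsOpen u ∧ IsOpen v ∧ (z : X × Y).1 ∈ u ∧
      (z : X × Y).2 ∈ v ∧ u ×ˢ v ⊆ O := fun z => isOpen_prod_iff.1 hO' _ _ z.2
  choose u v hu hv hzu hzv huv using key
  obtain ⟨T, hT, hTU⟩ := TopologicalSpace.isOpen_iUnion_countable
    (fun z : O => Prod.map f g ⁻¹' (u z ×ˢ v z)) fun z => ((hu z).prod (hv z)).preimage hc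
  have hOeq : O = ⋃ z ∈ T, u z ×ˢ v z := by
    apply Set.Subset.antisymm
    · intro w hw
      obtain ⟨p, rfl⟩ := hs w
      have h1 : p ∈ ⋃ z : O, Prod.map f g ⁻¹' (u z ×ˢ v z) :=
        Set.mem_iUnion.2 ⟨⟨_, hw⟩, hzu ⟨_, hw⟩, hzv ⟨_, hw⟩⟩
      rw [← hTU] at h1
      simpa only [Set.mem_iUnion, Set.mem_preimage] using h1
    · exact Set.iUnion₂_subset fun z _ => huv z
  rw [hOeq]
  exact MeasurableSet.biUnion hT fun z _ => (hu z).measurableSet.prod (hv z).measurableSet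

/-- A measure is non-atomic if it has no atoms: every measurable set of positive measure has a
measurable subset of strictly smaller positive measure. (For a finite Borel measure on a
Hausdorff Souslin space this amounts to all points having measure zero.) -/
def IsNonAtomic {X : Type*} [MeasurableSpace X] (m : Measure X) : Prop :=
  ∀ A : Set X, MeasurableSet A → 0 < m A →
    ∃ B : Set X, B ⊆ A ∧ MeasurableSet B ∧ 0 < m B ∧ m B < m A

/-- A real function is universally measurable if preimages of Borel sets are measurable with
respect to the completion of every probability measure. -/
def IsUniversallyMeasurable {X : Type*} [MeasurableSpace X] (u : X → ℝ) : Prop :=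
  ∀ m : Measure X, IsProbabilityMeasure m → NullMeasurable u m

/-- The set `Π(μ, ν)` of transport plans: probability measures on the product with projections
`μ` and `ν`. -/
def transportPlans {X Y : Type*} [MeasurableSpace X] [MeasurableSpace Y]
    (μ : Measure X) (ν : Measure Y) : Set (Measure (X × Y)) :=
  {σ | IsProbabilityMeasure σ ∧ σ.map Prod.fst = μ ∧ σ.map Prod.snd = ν}

/-- The set `Π_Φ(μ, ν; η)` of transport plans that have a density with respect to `η` which is
at most `Φ` almost everywhere. -/
def constrainedPlans {X Y : Type*} [MeasurableSpace X] [MeasurableSpace Y]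
    (Φ : X × Y → ℝ) (μ : Measure X) (ν : Measure Y) (η : Measure (X × Y)) :
    Set (Measure (X × Y)) :=
  {σ | σ ∈ transportPlans μ ν ∧ σ ≪ η ∧ ∀ᵐ z ∂η, (σ.rnDeriv η z).toReal ≤ Φ z}

/-- The functional `I_h(σ) = ∫ h dσ`, with values in the extended reals: the integral of the
positive part minus that of the negative part. For `h` bounded below and `σ` finite the latter
is finite, so the value lies in `(-∞, +∞]`. -/
noncomputable def transportCost {X Y : Type*} [MeasurableSpace X] [MeasurableSpace Y]
    (h : X × Y → ℝ) (σ : Measure (X × Y)) : EReal :=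
  ((∫⁻ z, ENNReal.ofReal (h z) ∂σ : ENNReal) : EReal) -
    ((∫⁻ z, ENNReal.ofReal (-h z) ∂σ : ENNReal) : EReal)

/-- `σ` is an optimal solution of the Kantorovich problem with density constraints:
`I_h(σ) → inf`, `σ ∈ Π_Φ(μ, ν; η)`. -/
def IsOptimalPlan {X Y : Type*} [MeasurableSpace X] [MeasurableSpace Y]
    (h Φ : X × Y → ℝ) (μ : Measure X) (ν : Measure Y) (η σ : Measure (X × Y)) : Prop :=
  σ ∈ constrainedPlans Φ μ ν η ∧
    ∀ τ ∈ constrainedPlans Φ μ ν η, transportCost h σ ≤ transportCost h τ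

/-- The non-degeneracy condition: there are no universally measurable `u`, `v` such that
`h(x, y) = u(x) + v(y)` on a set of positive `η`-measure. -/
def IsNonDegenerateCost {X Y : Type*} [MeasurableSpace X] [MeasurableSpace Y]
    (h : X × Y → ℝ) (η : Measure (X × Y)) : Prop :=
  ¬ ∃ (u : X → ℝ) (v : Y → ℝ), IsUniversallyMeasurable u ∧ IsUniversallyMeasurable v ∧
    0 < η {z : X × Y | h z = u z.1 + v z.2}

/-! After adding a constant to `h`, the problem is to minimize a nonnegative integral over plans
dominated by the finite measure `m = Φ · η`. Viewed as set functions, the finitely additive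
competitors below `m` form a compact set on which the cost is lower semicontinuous, and domination
by `m` makes the limit a measure (`exists_minimizer_of_measure_le`).

A minimizing density `f` must be extreme, `f = 0` or `f = Φ` a.e. Otherwise some `A` with `η A > 0`
leaves room to add and remove mass. Exchanging the diagonals of the rectangles with all corners in
`A` preserves both marginals, so optimality forces `h(x, y) + h(x', y') = h(x, y') + h(x', y)` for
almost all of them (`ae_fourCycles_eq`). These rectangles have positive measure
(`measure_fourCycles_ne_zero`), so fixing one corner by Fubini gives `h = u + v` on a set of
positive measure, against non-degeneracy (`ae_eq_zero_or_eq_of_minimizer`).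

Uniqueness follows because the mean of two minimizers is a minimizer: where their densities differ,
its density is `Φ / 2`, which is not extreme. -/

open scoped ENNReal Topology

/-! ### Existence of minimizers by compactness -/

/-- A finitely additive set function that is dominated by a finite measure is a measure. -/
theorem exists_measure_eq_of_finitelyAdditive {Z : Type*} [MeasurableSpace Z] (m : Measure Z)
    [IsFiniteMeasure m] (s : Set Z → ℝ≥0∞) (hle : ∀ S, MeasurableSet S → s S ≤ m S)
    (hadd : ∀ S T, MeasurableSet S → MeasurableSet T → Disjoint S T → s (S ∪ T) = s S + s T) :
    ∃ σ : Measure Z, ∀ S, MeasurableSet S → σ S = s S := by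
  have h0 : s ∅ = 0 := by simpa using hle ∅ MeasurableSet.empty
  refine ⟨Measure.ofMeasurable (fun S _ => s S) h0 ?_, fun S hS => Measure.ofMeasurable_apply S hS⟩
  intro F hF hd
  have hpart : ∀ n : ℕ, s (⋃ i, F i) =
      ∑ i ∈ Finset.range n, s (F i) + s (⋃ i, F (i + n)) := by
    intro n
    induction n with
    | zero => simp
    | succ n ih =>
      have h1 : (⋃ i, F (i + n)) = F n ∪ ⋃ i, F (i + (n + 1)) := by
        ext z
        simp only [Set.mem_iUnion, Set.mem_union]
        constructor
        · rintro ⟨i, hi⟩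
          rcases i with _ | i
          · left; simpa using hi
          · right; exact ⟨i, by convert hi using 2; omega⟩
        · rintro (hz | ⟨i, hi⟩)
          · exact ⟨0, by simpa using hz⟩
          · exact ⟨i + 1, by convert hi using 2; omega⟩
      rw [ih, h1, hadd _ _ (hF n) (MeasurableSet.iUnion fun i => hF _), Finset.sum_range_succ,
        add_assoc]
      rw [Set.disjoint_iUnion_right]
      exact fun i => hd (by omega)
  -- Domination supplies countable additivity: the remainder is at most the tail of the convergent
  -- series `∑ m (F i)`.
  have htail : Filter.Tendsto (fun n => s (⋃ i, F (i + n))) Filter.atTop (𝓝 0) := by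
    have hsum : ∑' i, m (F i) ≠ ∞ := by
      rw [← measure_iUnion hd hF]; exact measure_ne_top _ _
    refine tendsto_of_tendsto_of_tendsto_of_le_of_le tendsto_const_nhds
      (ENNReal.tendsto_sum_nat_add (fun i => m (F i)) hsum) (fun _ => zero_le) fun n => ?_
    exact (hle _ (MeasurableSet.iUnion fun i => hF _)).trans (measure_iUnion_le _)
  have hlim := (ENNReal.tendsto_nat_tsum fun i => s (F i)).add htail
  rw [add_zero] at hlim
  exact tendsto_nhds_unique (tendsto_const_nhds.congr hpart) hlim

/-- A nonnegative linear functional attains its minimum on the set of measures that are dominated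
by a given finite measure and have prescribed values on a family of sets. -/
theorem exists_minimizer_of_measure_le {Z ι : Type*} [MeasurableSpace Z] (m : Measure Z)
    [IsFiniteMeasure m] (S : ι → Set Z) (hS : ∀ i, MeasurableSet (S i)) (c : ι → ℝ≥0∞)
    (H : Z → ℝ≥0∞) (hne : ∃ σ : Measure Z, σ ≤ m ∧ ∀ i, σ (S i) = c i) :
    ∃ σ : Measure Z, (σ ≤ m ∧ ∀ i, σ (S i) = c i) ∧
      ∀ τ : Measure Z, τ ≤ m → (∀ i, τ (S i) = c i) → ∫⁻ z, H z ∂σ ≤ ∫⁻ z, H z ∂τ := by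
  -- Each condition constrains finitely many coordinates, so `K` is closed in the compact product of
  -- copies of `[0, ∞]`.
  let K : Set (Set Z → ℝ≥0∞) :=
    {s | ∀ A, MeasurableSet A → s A ≤ m A} ∩
      ({s | ∀ A B, MeasurableSet A → MeasurableSet B → Disjoint A B → s (A ∪ B) = s A + s B} ∩
        {s | ∀ i, s (S i) = c i})
  -- The lower integral, written so that it makes sense for any set function; a supremum of finite
  -- sums continuous in `s`.
  let F : (Set Z → ℝ≥0∞) → ℝ≥0∞ := fun s =>
    ⨆ (φ : SimpleFunc Z NNReal) (_ : ∀ x, (φ x : ℝ≥0∞) ≤ H x),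
      ∑ x ∈ (φ.map ((↑) : NNReal → ℝ≥0∞)).range, x * s (φ.map (↑) ⁻¹' {x})
  have hF : ∀ (σ : Measure Z) (s : Set Z → ℝ≥0∞), (∀ A, MeasurableSet A → σ A = s A) →
      ∫⁻ z, H z ∂σ = F s := by
    intro σ s hs
    rw [lintegral_eq_nnreal]
    refine iSup_congr fun φ => iSup_congr fun _ => ?_
    exact Finset.sum_congr rfl fun x _ => by rw [hs _ (SimpleFunc.measurableSet_preimage _ _)]
  have hKmem : ∀ σ : Measure Z, σ ≤ m → (∀ i, σ (S i) = c i) → (fun A => σ A) ∈ K :=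
    fun σ hσ hσ' => ⟨fun A _ => hσ A, fun A B _ hB hd => measure_union hd hB, hσ'⟩
  have hclosed : IsClosed K := by
    refine IsClosed.inter ?_ (IsClosed.inter ?_ ?_)
    · simp only [Set.ofPred_forall]
      exact isClosed_iInter fun A => isClosed_iInter fun _ =>
        isClosed_le (continuous_apply A) continuous_const
    · simp only [Set.ofPred_forall]
      exact isClosed_iInter fun A => isClosed_iInter fun B => isClosed_iInter fun _ =>
        isClosed_iInter fun _ => isClosed_iInter fun _ =>
        isClosed_eq (continuous_apply _) ((continuous_apply A).add (continuous_apply B))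
    · simp only [Set.ofPred_forall]
      exact isClosed_iInter fun i => isClosed_eq (continuous_apply _) continuous_const
  have hlsc : LowerSemicontinuous F := by
    refine lowerSemicontinuous_iSup fun φ => lowerSemicontinuous_iSup fun _ => ?_
    refine Continuous.lowerSemicontinuous (continuous_finsetSum _ fun x hx => ?_)
    -- Multiplication by a constant is continuous on `[0, ∞]` because the constant, a value of an
    -- `NNReal` simple function, is finite.
    refine (ENNReal.continuous_const_mul ?_).comp (continuous_apply _)
    obtain ⟨z, rfl⟩ := SimpleFunc.mem_range.1 hx
    simp
  obtain ⟨σ₀, hσ₀, hσ₀'⟩ := hne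
  obtain ⟨s, hs, hmin⟩ := (hlsc.lowerSemicontinuousOn K).exists_isMinOn
    ⟨_, hKmem σ₀ hσ₀ hσ₀'⟩ hclosed.isCompact
  obtain ⟨σ, hσ⟩ := exists_measure_eq_of_finitelyAdditive m s hs.1 hs.2.1
  refine ⟨σ, ⟨?_, fun i => by rw [hσ _ (hS i), hs.2.2 i]⟩, fun τ hτ hτ' => ?_⟩
  · exact Measure.le_iff.2 fun A hA => (hσ A hA).le.trans (hs.1 A hA)
  · rw [hF σ s hσ, hF τ _ fun _ _ => rfl]
    exact hmin (hKmem τ hτ hτ')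

/-! ### Perturbations along four-cycles -/

/-- First-order optimality: replacing a part `β` of a minimizer by a measure `α` with the same
marginals does not lower the cost. -/
theorem lintegral_le_of_perturbation {X Y : Type*} [MeasurableSpace X] [MeasurableSpace Y]
    {σ m α β : Measure (X × Y)} [IsFiniteMeasure σ] {H : X × Y → ℝ≥0∞}
    (hfin : ∫⁻ z, H z ∂σ ≠ ∞)
    (hopt : ∀ τ ≤ m, τ.map Prod.fst = σ.map Prod.fst → τ.map Prod.snd = σ.map Prod.snd →
      ∫⁻ z, H z ∂σ ≤ ∫⁻ z, H z ∂τ)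
    (hβ : β ≤ σ) (hα : σ + α ≤ m) (hfst : α.map Prod.fst = β.map Prod.fst)
    (hsnd : α.map Prod.snd = β.map Prod.snd) : ∫⁻ z, H z ∂β ≤ ∫⁻ z, H z ∂α := by
  have : IsFiniteMeasure β := isFiniteMeasure_of_le σ hβ
  have hsum : σ - β + β = σ := Measure.sub_add_cancel_of_le hβ
  have h1 := hopt (σ - β + α) ((add_le_add_left Measure.sub_le _).trans hα)
    (by rw [Measure.map_add _ _ measurable_fst, hfst, ← Measure.map_add _ _ measurable_fst, hsum])
    (by rw [Measure.map_add _ _ measurable_snd, hsnd, ← Measure.map_add _ _ measurable_snd, hsum])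
  have h2 : ∫⁻ z, H z ∂σ = ∫⁻ z, H z ∂(σ - β) + ∫⁻ z, H z ∂β := by
    rw [← lintegral_add_measure, hsum]
  rw [lintegral_add_measure, h2] at h1
  refine (ENNReal.add_le_add_iff_left ?_).1 h1
  exact ne_top_of_le_ne_top hfin (h2 ▸ le_self_add)

/-- If `B ⊆ X × Y` is not null, then neither is the set of pairs of points of `B` with a common
second coordinate. -/
theorem measure_pairs_ne_zero {X Y : Type*} [MeasurableSpace X] [MeasurableSpace Y]
    (μ : Measure X) (ν : Measure Y) [SFinite μ] [SFinite ν] {B : Set (X × Y)}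
    (hB : MeasurableSet B) (h : μ.prod ν B ≠ 0) :
    (μ.prod μ).prod ν {p | (p.1.1, p.2) ∈ B ∧ (p.1.2, p.2) ∈ B} ≠ 0 := by
  have hm : MeasurableSet {p : (X × X) × Y | (p.1.1, p.2) ∈ B ∧ (p.1.2, p.2) ∈ B} :=
    (hB.preimage (f := fun p : (X × X) × Y => (p.1.1, p.2)) (by fun_prop)).inter
      (hB.preimage (f := fun p : (X × X) × Y => (p.1.2, p.2)) (by fun_prop))
  contrapose! h
  rw [Measure.prod_apply_symm hm, lintegral_eq_zero_iff (measurable_measure_prodMk_right hm)] at h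
  rw [Measure.prod_apply_symm hB, lintegral_eq_zero_iff (measurable_measure_prodMk_right hB)]
  filter_upwards [h] with y hy
  -- The fibre over `y` is the square of the fibre of `B`, so its measure is a square and vanishes
  -- only if the fibre of `B` is null.
  have hprod : (fun x : X × X => (x, y)) ⁻¹' {p | (p.1.1, p.2) ∈ B ∧ (p.1.2, p.2) ∈ B} =
      ((fun x => (x, y)) ⁻¹' B) ×ˢ ((fun x => (x, y)) ⁻¹' B) := rfl
  rw [hprod, Measure.prod_prod] at hy
  simpa using hy

/-- The set of four-cycles `(x, y), (x', y'), (x, y'), (x', y)` in a set `A`, parametrized by the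
pair `((x, y), (x', y'))`. -/
def fourCycles {X Y : Type*} (A : Set (X × Y)) : Set ((X × Y) × (X × Y)) :=
  {p | (p.1 ∈ A ∧ p.2 ∈ A) ∧ (p.1.1, p.2.2) ∈ A ∧ (p.2.1, p.1.2) ∈ A}

section FourCycles

variable {X Y : Type*} [MeasurableSpace X] [MeasurableSpace Y]

theorem measurableSet_fourCycles {A : Set (X × Y)} (hA : MeasurableSet A) :
    MeasurableSet (fourCycles A) :=
  ((hA.preimage measurable_fst).inter (hA.preimage measurable_snd)).inter
    ((hA.preimage (f := fun p : (X × Y) × (X × Y) => (p.1.1, p.2.2)) (by fun_prop)).inter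
      (hA.preimage (f := fun p : (X × Y) × (X × Y) => (p.2.1, p.1.2)) (by fun_prop)))

/-- A set of positive product measure contains a non-null set of four-cycles. -/
theorem measure_fourCycles_ne_zero (μ : Measure X) (ν : Measure Y) [SFinite μ] [SFinite ν]
    {A : Set (X × Y)} (hA : MeasurableSet A) (h : μ.prod ν A ≠ 0) :
    (μ.prod ν).prod (μ.prod ν) (fourCycles A) ≠ 0 := by
  have h1 := measure_pairs_ne_zero μ ν hA h
  set B : Set ((X × X) × Y) := {p | (p.1.1, p.2) ∈ A ∧ (p.1.2, p.2) ∈ A}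
  have hB : MeasurableSet B :=
    (hA.preimage (f := fun p : (X × X) × Y => (p.1.1, p.2)) (by fun_prop)).inter
      (hA.preimage (f := fun p : (X × X) × Y => (p.1.2, p.2)) (by fun_prop))
  have hswap := Measure.measurePreserving_swap (μ := ν) (ν := μ.prod μ)
  -- Having doubled `x`, the same lemma with the factors swapped doubles `y`.
  have h2 := measure_pairs_ne_zero ν (μ.prod μ) (hB.preimage measurable_swap)
    (by rwa [hswap.measure_preimage hB.nullMeasurableSet])
  set C : Set ((Y × Y) × (X × X)) :=
    {p | (p.1.1, p.2) ∈ Prod.swap ⁻¹' B ∧ (p.1.2, p.2) ∈ Prod.swap ⁻¹' B}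
  have hC : MeasurableSet C :=
    ((hB.preimage measurable_swap).preimage
      (f := fun p : (Y × Y) × (X × X) => (p.1.1, p.2)) (by fun_prop)).inter
      ((hB.preimage measurable_swap).preimage
        (f := fun p : (Y × Y) × (X × X) => (p.1.2, p.2)) (by fun_prop))
  -- The composite sends `((x, y), (x', y'))` to `((y', y), (x, x'))`.
  have e1 := measurePreserving_prodAssoc μ ν (μ.prod ν)
  have e2 := (MeasurePreserving.id μ).prod
    (Measure.measurePreserving_swap (μ := ν) (ν := μ.prod ν))
  have e3 := (MeasurePreserving.id μ).prod (measurePreserving_prodAssoc μ ν ν)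
  have e4 := (measurePreserving_prodAssoc μ μ (ν.prod ν)).symm
  have e5 := Measure.measurePreserving_swap (μ := μ.prod μ) (ν := ν.prod ν)
  have e := e5.comp (e4.comp (e3.comp (e2.comp e1)))
  rw [← e.measure_preimage hC.nullMeasurableSet] at h2
  convert h2 using 2
  ext ⟨⟨x, y⟩, ⟨x', y'⟩⟩
  simp only [fourCycles, C, B, Set.mem_preimage, Set.mem_ofPred_eq, Function.comp_apply,
    MeasurableEquiv.prodAssoc, MeasurableEquiv.coe_mk, MeasurableEquiv.symm_mk,
    Equiv.prodAssoc_apply, Equiv.prodAssoc_symm_apply, Prod.map, Prod.swap, id]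
  tauto

theorem map_restrict_le_restrict {Z W : Type*} [MeasurableSpace Z] [MeasurableSpace W]
    {γ : Measure Z} {η : Measure W} {p : Z → W} (hp : MeasurePreserving p γ η) {Q : Set Z}
    {A : Set W} (hA : MeasurableSet A) (hQ : ∀ z ∈ Q, p z ∈ A) :
    (γ.restrict Q).map p ≤ η.restrict A := by
  have h : γ.restrict Q ≤ γ.restrict (p ⁻¹' A) := Measure.restrict_mono hQ le_rfl
  refine (Measure.map_mono h hp.measurable).trans ?_
  rw [← Measure.restrict_map hp.measurable hA, hp.map_eq]

theorem measurePreserving_fst_snd (μ : Measure X) (ν : Measure Y) [IsProbabilityMeasure μ]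
    [IsProbabilityMeasure ν] :
    MeasurePreserving (fun p : (X × Y) × (X × Y) => (p.1.1, p.2.2))
      ((μ.prod ν).prod (μ.prod ν)) (μ.prod ν) :=
  (measurePreserving_fst (μ := μ) (ν := ν)).prod (measurePreserving_snd (μ := μ) (ν := ν))

theorem measurePreserving_snd_fst (μ : Measure X) (ν : Measure Y) [IsProbabilityMeasure μ]
    [IsProbabilityMeasure ν] :
    MeasurePreserving (fun p : (X × Y) × (X × Y) => (p.2.1, p.1.2))
      ((μ.prod ν).prod (μ.prod ν)) (μ.prod ν) :=
  (measurePreserving_fst_snd μ ν).comp Measure.measurePreserving_swap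

/-- If the mass of a minimizer `σ` may be both increased and decreased on `A`, then the alternating
sums of the cost along almost all four-cycles in `A` vanish. -/
theorem ae_fourCycles_eq {m : Measure (X × Y)} (μ : Measure X) (ν : Measure Y)
    [IsProbabilityMeasure μ] [IsProbabilityMeasure ν] {σ : Measure (X × Y)} [IsFiniteMeasure σ]
    {H : X × Y → ℝ≥0∞} (hH : Measurable H) (hfin : ∫⁻ z, H z ∂σ ≠ ∞)
    (hopt : ∀ τ ≤ m, τ.map Prod.fst = σ.map Prod.fst → τ.map Prod.snd = σ.map Prod.snd →
      ∫⁻ z, H z ∂σ ≤ ∫⁻ z, H z ∂τ)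
    {A : Set (X × Y)} (hA : MeasurableSet A) {ε : ℝ≥0∞} (hε : ε ≠ 0) (hε' : ε ≠ ∞)
    (hlow : ε • (μ.prod ν).restrict A ≤ σ) (hup : σ + ε • (μ.prod ν).restrict A ≤ m) :
    ∀ᵐ p ∂(μ.prod ν).prod (μ.prod ν), p ∈ fourCycles A →
      H p.1 + H p.2 = H (p.1.1, p.2.2) + H (p.2.1, p.1.2) := by
  set η := μ.prod ν
  set γ := η.prod η
  have p1 : MeasurePreserving Prod.fst γ η := measurePreserving_fst
  have p2 : MeasurePreserving Prod.snd γ η := measurePreserving_snd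
  have p3 : MeasurePreserving (fun p : (X × Y) × (X × Y) => (p.1.1, p.2.2)) γ η :=
    measurePreserving_fst_snd μ ν
  have p4 : MeasurePreserving (fun p : (X × Y) × (X × Y) => (p.2.1, p.1.2)) γ η :=
    measurePreserving_snd_fst μ ν
  have hcyc := measurableSet_fourCycles hA
  -- Letting `Q` be arbitrary turns equality of integrals into equality almost everywhere.
  have key : ∀ Q ⊆ fourCycles A, MeasurableSet Q →
      ∫⁻ p in Q, H p.1 + H p.2 ∂γ = ∫⁻ p in Q, H (p.1.1, p.2.2) + H (p.2.1, p.1.2) ∂γ := by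
    intro Q hQ hQm
    set γ' := γ.restrict Q
    -- `α` and `β` carry the two diagonals of the rectangles. Each is a sum of two measures below
    -- `η.restrict A`, hence the factor `ε / 2`.
    set α := (ε / 2) • (γ'.map Prod.fst + γ'.map Prod.snd)
    set β := (ε / 2) • (γ'.map (fun p => (p.1.1, p.2.2)) + γ'.map (fun p => (p.2.1, p.1.2)))
    have hhalf : ∀ a b : Measure (X × Y), a ≤ η.restrict A → b ≤ η.restrict A →
        (ε / 2) • (a + b) ≤ ε • η.restrict A := by
      intro a b ha hb S
      have := add_le_add (ha S) (hb S)
      simp only [Measure.smul_apply, Measure.add_apply, smul_eq_mul]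
      calc ε / 2 * (a S + b S) ≤ ε / 2 * (η.restrict A S + η.restrict A S) := by gcongr
        _ = ε * η.restrict A S := by
          rw [← two_mul, ← mul_assoc, ENNReal.div_mul_cancel two_ne_zero ENNReal.ofNat_ne_top]
    have hα : α ≤ ε • η.restrict A := hhalf _ _
      (map_restrict_le_restrict p1 hA fun z hz => (hQ hz).1.1)
      (map_restrict_le_restrict p2 hA fun z hz => (hQ hz).1.2)
    have hβ : β ≤ ε • η.restrict A := hhalf _ _
      (map_restrict_le_restrict p3 hA fun z hz => (hQ hz).2.1)
      (map_restrict_le_restrict p4 hA fun z hz => (hQ hz).2.2)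
    have hfst : α.map Prod.fst = β.map Prod.fst := by
      simp only [α, β, Measure.map_smul, Measure.map_add _ _ measurable_fst]
      rw [Measure.map_map measurable_fst p1.measurable, Measure.map_map measurable_fst p2.measurable,
        Measure.map_map measurable_fst p3.measurable, Measure.map_map measurable_fst p4.measurable]
      rfl
    have hsnd : α.map Prod.snd = β.map Prod.snd := by
      simp only [α, β, Measure.map_smul, Measure.map_add _ _ measurable_snd]
      rw [Measure.map_map measurable_snd p1.measurable, Measure.map_map measurable_snd p2.measurable,
        Measure.map_map measurable_snd p3.measurable, Measure.map_map measurable_snd p4.measurable,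
        add_comm]
      rfl
    -- There is room to trade `α` for `β` and `β` for `α`, so neither can be cheaper.
    have heq : ∫⁻ z, H z ∂α = ∫⁻ z, H z ∂β := le_antisymm
      (lintegral_le_of_perturbation hfin hopt (hα.trans hlow) ((add_le_add_right hβ σ).trans hup)
        hfst.symm hsnd.symm)
      (lintegral_le_of_perturbation hfin hopt (hβ.trans hlow) ((add_le_add_right hα σ).trans hup)
        hfst hsnd)
    simp only [α, β, lintegral_smul_measure, lintegral_add_measure] at heq
    rw [lintegral_map hH p1.measurable, lintegral_map hH p2.measurable,
      lintegral_map hH p3.measurable, lintegral_map hH p4.measurable] at heq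
    simp only [smul_eq_mul] at heq
    rw [lintegral_add_left (f := fun p : (X × Y) × (X × Y) => H p.1) (hH.comp p1.measurable),
      lintegral_add_left (f := fun p : (X × Y) × (X × Y) => H (p.1.1, p.2.2))
        (hH.comp p3.measurable)]
    exact (ENNReal.mul_right_inj (ENNReal.div_ne_zero.2 ⟨hε, by simp⟩)
      (ENNReal.div_ne_top hε' two_ne_zero)).1 heq
  have hF : Measurable fun p : (X × Y) × (X × Y) => H p.1 + H p.2 :=
    (hH.comp p1.measurable).add (hH.comp p2.measurable)
  have hG : Measurable fun p : (X × Y) × (X × Y) => H (p.1.1, p.2.2) + H (p.2.1, p.1.2) :=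
    (hH.comp p3.measurable).add (hH.comp p4.measurable)
  rw [← ae_restrict_iff' hcyc]
  refine ae_eq_of_forall_setLIntegral_eq_of_sigmaFinite hF hG fun s hs _ => ?_
  rw [Measure.restrict_restrict hs]
  exact key _ Set.inter_subset_right (hs.inter hcyc)

end FourCycles

section

variable {X Y : Type*} [MeasurableSpace X] [MeasurableSpace Y]

/-! ### Extremality of minimizing densities -/

/-- The density of a minimizer takes only the extreme values `0` and `φ`. -/
theorem ae_eq_zero_or_eq_of_minimizer (μ : Measure X) (ν : Measure Y)
    [IsProbabilityMeasure μ] [IsProbabilityMeasure ν] {h : X × Y → ℝ} (hh : Measurable h)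
    {c : ℝ} (hc : ∀ z, 0 ≤ h z + c) (hnd : IsNonDegenerateCost h (μ.prod ν))
    {f φ : X × Y → ℝ≥0∞} (hf : Measurable f) (hφ : Measurable φ) (hfφ : f ≤ᵐ[μ.prod ν] φ)
    [IsFiniteMeasure ((μ.prod ν).withDensity f)]
    (hfin : ∫⁻ z, ENNReal.ofReal (h z + c) ∂(μ.prod ν).withDensity f ≠ ∞)
    (hopt : ∀ τ ≤ (μ.prod ν).withDensity φ,
      τ.map Prod.fst = ((μ.prod ν).withDensity f).map Prod.fst →
      τ.map Prod.snd = ((μ.prod ν).withDensity f).map Prod.snd →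
      ∫⁻ z, ENNReal.ofReal (h z + c) ∂(μ.prod ν).withDensity f ≤
        ∫⁻ z, ENNReal.ofReal (h z + c) ∂τ) :
    ∀ᵐ z ∂μ.prod ν, f z = 0 ∨ f z = φ z := by
  set η := μ.prod ν
  -- In `ℝ≥0∞` the inverse of `0` is `∞`; the clause `n ≠ 0` keeps the increment finite.
  have hnull : ∀ n : ℕ, η {z | (n : ℝ≥0∞)⁻¹ ≤ f z ∧ f z + (n : ℝ≥0∞)⁻¹ ≤ φ z ∧ n ≠ 0} = 0 := by
    intro n
    rcases eq_or_ne n 0 with rfl | hn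
    · simp
    set ε : ℝ≥0∞ := (n : ℝ≥0∞)⁻¹
    set A : Set (X × Y) := {z | ε ≤ f z ∧ f z + ε ≤ φ z ∧ n ≠ 0}
    have hA : MeasurableSet A :=
      (measurableSet_le measurable_const hf).inter
        ((measurableSet_le (hf.add measurable_const) hφ).inter (MeasurableSet.const _))
    have hAdens : ε • η.restrict A = η.withDensity (A.indicator fun _ => ε) := by
      rw [withDensity_indicator hA, withDensity_const]
    by_contra hpos
    have hcyc := ae_fourCycles_eq (m := η.withDensity φ) μ ν (hh.add_const c).ennreal_ofReal hfin
      hopt hA (ε := ε) (by simp [ε]) (by simpa [ε] using hn)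
      (by
        rw [hAdens]
        refine withDensity_mono (Filter.Eventually.of_forall fun z => ?_)
        exact Set.indicator_le (fun z hz => hz.1) z)
      (by
        rw [hAdens, ← withDensity_add_left hf]
        refine withDensity_mono ?_
        filter_upwards [hfφ] with z hz
        by_cases hzA : z ∈ A
        · simpa [hzA] using hzA.2.1
        · simpa [hzA] using hz)
    have hcpos := measure_fourCycles_ne_zero μ ν hA hpos
    refine hcpos ((Measure.measure_prod_null (measurableSet_fourCycles hA)).2 ?_)
    filter_upwards [Measure.ae_ae_of_ae_prod hcyc] with z₀ hz₀
    by_contra hz₀pos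
    -- With the corner `z₀ = (x₀, y₀)` fixed, the cycle identity reads `h(x, y) = h(x, y₀) + h(x₀,
    -- y) - h(x₀, y₀)`.
    refine hnd ⟨fun x => h (x, z₀.2), fun y => h (z₀.1, y) - h z₀, ?_, ?_,
      (pos_iff_ne_zero.2 hz₀pos).trans_le (measure_mono_ae ?_)⟩
    · exact fun _ _ => (hh.comp measurable_prodMk_right).nullMeasurable
    · exact fun _ _ => ((hh.comp measurable_prodMk_left).sub_const _).nullMeasurable
    · filter_upwards [hz₀] with z hz hzc
      have hsum := congrArg ENNReal.toReal (hz hzc)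
      simp only [ENNReal.toReal_add ENNReal.ofReal_ne_top ENNReal.ofReal_ne_top,
        ENNReal.toReal_ofReal (hc _)] at hsum
      change h z = h (z.1, z₀.2) + (h (z₀.1, z.2) - h z₀)
      linarith
  have hall : ∀ᵐ z ∂η, ∀ n : ℕ,
      ¬ ((n : ℝ≥0∞)⁻¹ ≤ f z ∧ f z + (n : ℝ≥0∞)⁻¹ ≤ φ z ∧ n ≠ 0) := by
    rw [ae_all_iff]
    intro n
    rw [ae_iff]
    simpa using hnull n
  filter_upwards [hall, hfφ] with z hz hle
  by_contra! hne
  have hlt : f z < φ z := lt_of_le_of_ne hle hne.2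
  obtain ⟨n, hn⟩ := ENNReal.exists_inv_nat_lt
    (a := min (f z) (φ z - f z)) (lt_min (pos_iff_ne_zero.2 hne.1) (tsub_pos_of_lt hlt)).ne'
  refine hz n ⟨(hn.trans_le (min_le_left _ _)).le, ?_, ?_⟩
  · calc f z + (n : ℝ≥0∞)⁻¹ ≤ f z + (φ z - f z) := by
          gcongr; exact (hn.trans_le (min_le_right _ _)).le
      _ = φ z := add_tsub_cancel_of_le hle
  · rintro rfl
    simp at hn

/-! ### Reformulation by nonnegative integrals and domination of measures -/

theorem transportCost_add_const {h : X × Y → ℝ} (hh : Measurable h) {c : ℝ} (hc0 : 0 ≤ c)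
    (hc : ∀ z, 0 ≤ h z + c) (σ : Measure (X × Y)) [IsProbabilityMeasure σ] :
    transportCost h σ = ((∫⁻ z, ENNReal.ofReal (h z + c) ∂σ : ℝ≥0∞) : EReal) - (c : EReal) := by
  have h1 : ∫⁻ z, ENNReal.ofReal (h z + c) ∂σ + ∫⁻ z, ENNReal.ofReal (-h z) ∂σ =
      ∫⁻ z, ENNReal.ofReal (h z) ∂σ + ENNReal.ofReal c := by
    have : ENNReal.ofReal c = ∫⁻ _, ENNReal.ofReal c ∂σ := by simp
    rw [this, ← lintegral_add_right (g := fun z => ENNReal.ofReal (-h z)) _ hh.neg.ennreal_ofReal,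
      ← lintegral_add_right _ measurable_const]
    refine lintegral_congr fun z => ?_
    rcases le_total 0 (h z) with h0 | h0
    · rw [ENNReal.ofReal_of_nonpos (neg_nonpos.2 h0), add_zero, ENNReal.ofReal_add h0 hc0]
    · rw [ENNReal.ofReal_of_nonpos h0, zero_add, ← ENNReal.ofReal_add (hc z) (neg_nonneg.2 h0)]
      congr 1; ring
  have h2 : ∫⁻ z, ENNReal.ofReal (-h z) ∂σ ≠ ∞ := by
    refine ne_top_of_le_ne_top (b := ENNReal.ofReal c) ENNReal.ofReal_ne_top ?_
    calc ∫⁻ z, ENNReal.ofReal (-h z) ∂σ ≤ ∫⁻ _, ENNReal.ofReal c ∂σ :=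
          lintegral_mono fun z => ENNReal.ofReal_le_ofReal (by linarith [hc z])
      _ = ENNReal.ofReal c := by simp
  unfold transportCost
  generalize ∫⁻ z, ENNReal.ofReal (h z + c) ∂σ = J at *
  generalize ∫⁻ z, ENNReal.ofReal (-h z) ∂σ = N at *
  generalize ∫⁻ z, ENNReal.ofReal (h z) ∂σ = P at *
  lift N to NNReal using h2
  rcases eq_or_ne J ∞ with rfl | hJ
  · have hP : P = ∞ := by
      by_contra hP
      rw [top_add] at h1
      exact (ENNReal.add_ne_top.2 ⟨hP, ENNReal.ofReal_ne_top⟩) h1.symm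
    subst hP
    rw [EReal.coe_ennreal_top, EReal.top_sub_coe]
    exact EReal.top_sub_coe N
  · have hP : P ≠ ∞ := by
      rintro rfl
      rw [top_add] at h1
      exact (ENNReal.add_ne_top.2 ⟨hJ, ENNReal.coe_ne_top⟩) h1
    lift J to NNReal using hJ
    lift P to NNReal using hP
    have h3 : (J : ℝ) + N = P + c := by
      have := congrArg ENNReal.toReal h1
      rwa [ENNReal.toReal_add ENNReal.coe_ne_top ENNReal.coe_ne_top,
        ENNReal.toReal_add ENNReal.coe_ne_top ENNReal.ofReal_ne_top,
        ENNReal.toReal_ofReal hc0] at this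
    change (((P : ℝ) : EReal) - ((N : ℝ) : EReal)) = (((J : ℝ) : EReal) - (c : EReal))
    norm_cast
    linarith

/-- Domination is the form of the density bound that survives limits of set functions. Nonnegativity
of `Φ` matters because `ENNReal.ofReal` truncates negative values. -/
theorem mem_constrainedPlans_iff {Φ : X × Y → ℝ} {μ : Measure X} {ν : Measure Y}
    {η : Measure (X × Y)} [IsFiniteMeasure η] (hΦ : ∀ᵐ z ∂η, 0 ≤ Φ z) {σ : Measure (X × Y)} :
    σ ∈ constrainedPlans Φ μ ν η ↔
      σ ∈ transportPlans μ ν ∧ σ ≤ η.withDensity fun z => ENNReal.ofReal (Φ z) := by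
  constructor
  · rintro ⟨hσ, hac, hle⟩
    have := hσ.1
    refine ⟨hσ, ?_⟩
    rw [← Measure.withDensity_rnDeriv_eq σ η hac]
    refine withDensity_mono ?_
    filter_upwards [hle, hΦ, σ.rnDeriv_ne_top η] with z hz h0 hz'
    exact (ENNReal.le_ofReal_iff_toReal_le hz' h0).2 hz
  · rintro ⟨hσ, hle⟩
    have := hσ.1
    have hac : σ ≪ η := (Measure.absolutelyContinuous_of_le hle).trans
      (withDensity_absolutelyContinuous _ _)
    refine ⟨hσ, hac, ?_⟩
    have : σ.rnDeriv η ≤ᵐ[η] fun z => ENNReal.ofReal (Φ z) := by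
      refine ae_le_of_forall_setLIntegral_le_of_sigmaFinite (Measure.measurable_rnDeriv _ _) ?_
      intro s hs _
      rw [Measure.setLIntegral_rnDeriv hac, ← withDensity_apply _ hs]
      exact hle s
    filter_upwards [this, hΦ] with z hz hz'
    exact ENNReal.toReal_le_of_le_ofReal hz' hz

end

section

variable {X Y : Type*} [MeasurableSpace X] [MeasurableSpace Y]

/-- Puts the marginal conditions in the form of prescribed values on sets; total mass one comes from
`A = univ`. -/
theorem mem_transportPlans_iff {μ : Measure X} {ν : Measure Y} [IsProbabilityMeasure μ]
    {σ : Measure (X × Y)} :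
    σ ∈ transportPlans μ ν ↔ (∀ A, MeasurableSet A → σ (Prod.fst ⁻¹' A) = μ A) ∧
      ∀ B, MeasurableSet B → σ (Prod.snd ⁻¹' B) = ν B := by
  constructor
  · rintro ⟨_, rfl, rfl⟩
    exact ⟨fun A hA => (Measure.map_apply measurable_fst hA).symm,
      fun B hB => (Measure.map_apply measurable_snd hB).symm⟩
  · rintro ⟨h1, h2⟩
    refine ⟨⟨?_⟩, ?_, ?_⟩
    · simpa using h1 _ MeasurableSet.univ
    · exact Measure.ext fun A hA => by rw [Measure.map_apply measurable_fst hA, h1 A hA]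
    · exact Measure.ext fun B hB => by rw [Measure.map_apply measurable_snd hB, h2 B hB]

theorem inv_two_mul_add_self (a : ℝ≥0∞) : 2⁻¹ * (a + a) = a := by
  rw [← two_mul, ← mul_assoc, ENNReal.inv_mul_cancel two_ne_zero ENNReal.ofNat_ne_top, one_mul]

/-- Among the transport plans that are dominated by a finite measure there is one of least cost. -/
theorem exists_minimizer_transportPlans {μ : Measure X} {ν : Measure Y} [IsProbabilityMeasure μ]
    (m : Measure (X × Y)) [IsFiniteMeasure m] (H : X × Y → ℝ≥0∞)
    (hne : ∃ σ ∈ transportPlans μ ν, σ ≤ m) :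
    ∃ σ ∈ transportPlans μ ν, σ ≤ m ∧
      ∀ τ ∈ transportPlans μ ν, τ ≤ m → ∫⁻ z, H z ∂σ ≤ ∫⁻ z, H z ∂τ := by
  let S : {A : Set X // MeasurableSet A} ⊕ {B : Set Y // MeasurableSet B} → Set (X × Y) :=
    Sum.elim (fun A => Prod.fst ⁻¹' A.1) (fun B => Prod.snd ⁻¹' B.1)
  let c : {A : Set X // MeasurableSet A} ⊕ {B : Set Y // MeasurableSet B} → ℝ≥0∞ :=
    Sum.elim (fun A => μ A.1) (fun B => ν B.1)
  have hS : ∀ i, MeasurableSet (S i) := by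
    rintro (A | B)
    · exact measurable_fst A.2
    · exact measurable_snd B.2
  have hiff : ∀ σ : Measure (X × Y), (∀ i, σ (S i) = c i) ↔ σ ∈ transportPlans μ ν := by
    intro σ
    rw [mem_transportPlans_iff]
    simp [S, c]
  obtain ⟨σ₀, hσ₀, hσ₀m⟩ := hne
  obtain ⟨σ, ⟨hσm, hσ⟩, hmin⟩ := exists_minimizer_of_measure_le m S hS c H
    ⟨σ₀, hσ₀m, (hiff σ₀).2 hσ₀⟩
  exact ⟨σ, (hiff σ).1 hσ, hσm, fun τ hτ hτm => hmin τ hτm ((hiff τ).2 hτ)⟩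

theorem half_smul_add_mem_transportPlans {μ : Measure X} {ν : Measure Y} [IsProbabilityMeasure μ]
    {σ τ : Measure (X × Y)} (hσ : σ ∈ transportPlans μ ν) (hτ : τ ∈ transportPlans μ ν) :
    (2 : ℝ≥0∞)⁻¹ • (σ + τ) ∈ transportPlans μ ν := by
  rw [mem_transportPlans_iff] at *
  refine ⟨fun A hA => ?_, fun B hB => ?_⟩
  · rw [Measure.smul_apply, Measure.add_apply, hσ.1 A hA, hτ.1 A hA, smul_eq_mul,
      inv_two_mul_add_self]
  · rw [Measure.smul_apply, Measure.add_apply, hσ.2 B hB, hτ.2 B hB, smul_eq_mul,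
      inv_two_mul_add_self]

end

/-! ### Existence, uniqueness and form of the optimal plan -/

theorem theorem2 {X Y : Type*}
    [TopologicalSpace X] [MeasurableSpace X] [BorelSpace X]
    [TopologicalSpace Y] [MeasurableSpace Y] [BorelSpace Y]
    (hX : IsSouslinSpace X) (hY : IsSouslinSpace Y)
    (μ : Measure X) [IsProbabilityMeasure μ] (ν : Measure Y) [IsProbabilityMeasure ν]
    (η₁ : Measure X) [IsProbabilityMeasure η₁] (η₂ : Measure Y) [IsProbabilityMeasure η₂]
    (hη₁ : IsNonAtomic η₁) (hη₂ : IsNonAtomic η₂)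
    (Φ : X × Y → ℝ) (hΦ : Integrable Φ (η₁.prod η₂))
    (h : X × Y → ℝ) (h_meas : Measurable h) (h_bdd : BddBelow (Set.range h))
    (h_finite : ∃ σ ∈ constrainedPlans Φ μ ν (η₁.prod η₂), transportCost h σ < ⊤)
    (h_nondeg : IsNonDegenerateCost h (η₁.prod η₂)) :
    ∃ σ : Measure (X × Y),
      IsOptimalPlan h Φ μ ν (η₁.prod η₂) σ ∧
      (∀ τ : Measure (X × Y), IsOptimalPlan h Φ μ ν (η₁.prod η₂) τ → τ = σ) ∧
      ∃ W : Set (X × Y), MeasurableSet W ∧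
        σ = (η₁.prod η₂).withDensity (fun z => ENNReal.ofReal (W.indicator Φ z)) := by
  set η := η₁.prod η₂
  obtain ⟨b, hb⟩ := h_bdd
  obtain ⟨c, hc0, hc⟩ : ∃ c : ℝ, 0 ≤ c ∧ ∀ z, 0 ≤ h z + c :=
    ⟨max 0 (-b), le_max_left _ _, fun z => by
      linarith [le_max_right 0 (-b), hb (Set.mem_range_self z)]⟩
  obtain ⟨σ₀, hσ₀, hσ₀fin⟩ := h_finite
  have hΦ0 : ∀ᵐ z ∂η, 0 ≤ Φ z := hσ₀.2.2.mono fun z hz => ENNReal.toReal_nonneg.trans hz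
  have hplan : ∀ {σ : Measure (X × Y)}, σ ∈ constrainedPlans Φ μ ν η ↔
      σ ∈ transportPlans μ ν ∧ σ ≤ η.withDensity fun z => ENNReal.ofReal (Φ z) :=
    mem_constrainedPlans_iff hΦ0
  set m := η.withDensity fun z => ENNReal.ofReal (Φ z)
  have : IsFiniteMeasure m := isFiniteMeasure_withDensity_ofReal hΦ.2
  let J : Measure (X × Y) → ℝ≥0∞ := fun σ => ∫⁻ z, ENNReal.ofReal (h z + c) ∂σ
  have hcost : ∀ σ ∈ constrainedPlans Φ μ ν η, transportCost h σ = (J σ : EReal) - (c : EReal) :=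
    fun σ hσ => have := hσ.1.1; transportCost_add_const h_meas hc0 hc σ
  have hle : ∀ σ ∈ constrainedPlans Φ μ ν η, ∀ τ ∈ constrainedPlans Φ μ ν η,
      (transportCost h σ ≤ transportCost h τ ↔ J σ ≤ J τ) := by
    intro σ hσ τ hτ
    rw [hcost σ hσ, hcost τ hτ, ← EReal.coe_ennreal_le_coe_ennreal_iff]
    refine ⟨fun hst => ?_, fun hst => EReal.sub_le_sub hst le_rfl⟩
    have hst' := add_le_add_left hst (c : EReal)
    rwa [EReal.sub_add_cancel, EReal.sub_add_cancel] at hst'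
  have hJσ₀ : J σ₀ ≠ ∞ := by
    intro htop
    rw [hcost σ₀ hσ₀, htop, EReal.coe_ennreal_top, EReal.top_sub_coe] at hσ₀fin
    exact lt_irrefl _ hσ₀fin
  obtain ⟨σ, hσ, hσm, hmin⟩ := exists_minimizer_transportPlans m
    (fun z => ENNReal.ofReal (h z + c)) ⟨σ₀, hplan.1 hσ₀⟩
  have hσC : σ ∈ constrainedPlans Φ μ ν η := hplan.2 ⟨hσ, hσm⟩
  have hJσ : J σ ≠ ∞ := ne_top_of_le_ne_top hJσ₀ (hmin _ hσ₀.1 (hplan.1 hσ₀).2)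
  have hσopt : IsOptimalPlan h Φ μ ν η σ :=
    ⟨hσC, fun τ hτ => (hle σ hσC τ hτ).2 (hmin τ hτ.1 (hplan.1 hτ).2)⟩
  -- `Φ` itself is only a.e. strongly measurable, so a measurable representative is used.
  set φ : X × Y → ℝ≥0∞ := fun z => ENNReal.ofReal (hΦ.1.mk Φ z)
  have hφm : Measurable φ := hΦ.1.stronglyMeasurable_mk.measurable.ennreal_ofReal
  have hφ : (fun z => ENNReal.ofReal (Φ z)) =ᵐ[η] φ :=
    hΦ.1.ae_eq_mk.mono fun z hz => congrArg ENNReal.ofReal hz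
  have hmφ : m = η.withDensity φ := withDensity_congr_ae hφ
  have hextreme : ∀ τ ∈ constrainedPlans Φ μ ν η, J τ ≤ J σ →
      ∀ᵐ z ∂η, τ.rnDeriv η z = 0 ∨ τ.rnDeriv η z = φ z := by
    intro τ hτ hτJ
    have := hτ.1.1
    have hdens : η.withDensity (τ.rnDeriv η) = τ := Measure.withDensity_rnDeriv_eq τ η hτ.2.1
    have hfφ : τ.rnDeriv η ≤ᵐ[η] φ := by
      filter_upwards [hτ.2.2, τ.rnDeriv_ne_top η, hΦ0, hφ] with z hz hz' hz0 hzφ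
      rw [← hzφ]
      exact (ENNReal.le_ofReal_iff_toReal_le hz' hz0).2 hz
    refine ae_eq_zero_or_eq_of_minimizer η₁ η₂ h_meas hc h_nondeg (Measure.measurable_rnDeriv τ η)
      hφm hfφ ?_ ?_
    · rw [hdens]
      exact ne_top_of_le_ne_top hJσ hτJ
    · rw [hdens, ← hmφ, hτ.1.2.1, hτ.1.2.2]
      intro ρ hρm hρ1 hρ2
      refine hτJ.trans (hmin ρ ⟨⟨?_⟩, hρ1, hρ2⟩ hρm)
      rw [← Set.preimage_univ (f := Prod.fst), ← Measure.map_apply measurable_fst MeasurableSet.univ,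
        hρ1, measure_univ]
  refine ⟨σ, hσopt, fun τ hτ => ?_, {z | σ.rnDeriv η z ≠ 0},
    Measure.measurable_rnDeriv σ η (measurableSet_singleton 0).compl, ?_⟩
  · have := hσ.1
    have := hτ.1.1.1
    have hJτ : J τ ≤ J σ := (hle τ hτ.1 σ hσC).1 (hτ.2 σ hσC)
    set ρ := (2 : ℝ≥0∞)⁻¹ • (σ + τ) with hρ
    have hρC : ρ ∈ constrainedPlans Φ μ ν η := by
      refine hplan.2 ⟨half_smul_add_mem_transportPlans hσ hτ.1.1, fun S => ?_⟩
      calc ρ S = 2⁻¹ * (σ S + τ S) := rfl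
        _ ≤ 2⁻¹ * (m S + m S) := by
          gcongr
          exact (hplan.1 hτ.1).2
        _ = m S := inv_two_mul_add_self _
    have hρJ : J ρ ≤ J σ := by
      calc J ρ = 2⁻¹ * (J σ + J τ) := by
            simp only [J, ρ, lintegral_smul_measure, lintegral_add_measure, smul_eq_mul]
        _ ≤ 2⁻¹ * (J σ + J σ) := by gcongr
        _ = J σ := inv_two_mul_add_self _
    rw [← Measure.withDensity_rnDeriv_eq σ η hσC.2.1,
      ← Measure.withDensity_rnDeriv_eq τ η hτ.1.2.1]
    refine withDensity_congr_ae ?_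
    filter_upwards [hextreme σ hσC le_rfl, hextreme τ hτ.1 hJτ, hextreme ρ hρC hρJ,
      Measure.rnDeriv_smul_left_of_ne_top (σ + τ) η (r := 2⁻¹) (by simp),
      Measure.rnDeriv_add σ τ η] with z h1 h2 h3 h4 h5
    rw [← hρ] at h4
    rw [h4, Pi.smul_apply, h5, Pi.add_apply, smul_eq_mul] at h3
    have hφz : φ z ≠ ∞ := ENNReal.ofReal_ne_top
    rcases eq_or_ne (φ z) 0 with h0 | h0
    · rw [h0] at h1 h2
      rw [h1.elim id id, h2.elim id id]
    -- If exactly one of the two densities vanishes at `z`, that of `ρ` is `φ z / 2`, which is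
    -- neither `0` nor `φ z`.
    have hlt : 2⁻¹ * φ z ≠ φ z := by
      rw [mul_comm, ← div_eq_mul_inv]
      exact (ENNReal.half_lt_self h0 hφz).ne
    rcases h1 with h1 | h1 <;> rcases h2 with h2 | h2 <;> simp_all
  · have := hσ.1
    conv_lhs => rw [← Measure.withDensity_rnDeriv_eq σ η hσC.2.1]
    refine withDensity_congr_ae ?_
    filter_upwards [hextreme σ hσC le_rfl, hφ] with z h1 h2
    by_cases hz : σ.rnDeriv η z = 0
    · simp [hz]
    · rw [Set.indicator_of_mem (by exact hz), h2]
      exact h1.resolve_left hz
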